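/- Let $\mathbb{H}[q_1,q_2]$ be the ring of slice regular polynomials $P(q_1,q_2)=\sum_{n,m} q_1^n q_2^m a_{n,m}$ (finite sums, $a_{n,m}\in\mathbb{H}$), with the $*$-product determined by $(q_1^nq_2^ma)*(q_1^rq_2^sb)=q_1^{n+r}q_2^{m+s}ab$. For $a\in\mathbb{H}$ let $C_a=\{q\in\mathbb{H}: qa=aq\}$. If $P$ vanishes on $\{a\}\times C_a$, this zero is said to have multiplicity $m\in\mathbb{N}$ if $P=(q_1-a)^{*m}*Q$ for some $Q\in\mathbb{H}[q_1,q_2]$ that does not vanish identically on $\{a\}\times C_a$. The partial Cullen derivative of $P$ with respect to $q_1$ is $P_{q_1}=\sum_{n\ge1,m\ge0} n\,q_1^{n-1}q_2^m a_{n,m}$. Let $\mathcal{L}(\mathbb{H})$ be the skew field of left quotients $f^{-*}*g$ of slice regular functions on $\mathbb{H}$ (everywhere convergent power series $\sum_n q^n a_n$ with the $*$-product $\sum_n q^n\sum_{k\le n} a_k b_{n-k}$); it contains the ring $\mathbb{H}[q_2]$ of slice regular polynomials in one variable. For $P=\sum_{k=0}^{n} q_1^kP_k(q_2)$ and $Q=\sum_{k=0}^{m}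 q_1^kQ_k(q_2)$ with $n=\deg_{q_1}P$ and $m=\deg_{q_1}Q$, the regular resultant with respect to $q_1$, ${\rm Res}(P,Q;q_1)$, is the Dieudonné determinant over $\mathcal{L}(\mathbb{H})$ of the $(m+n)\times(m+n)$ Sylvester matrix whose first $m$ columns are the shifts of $(P_0,\dots,P_n)^t$ and whose last $n$ columns are the shifts of $(Q_0,\dots,Q_m)^t$. It is an element of the abelianization of $\mathcal{L}(\mathbb{H})\setminus\{0\}$ together with the class $[0]$. **Proposition.** Let $a\in\mathbb{H}$ and $b\in C_a$, and let $P\in\mathbb{H}[q_1,q_2]$ vanish at $(a,b)$. If $\{a\}\times C_a$ is a zero of $P$ of multiplicity $m\ge 2$, then ${\rm Res}(P,P_{q_1};q_1)\equiv 0$. -/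

import Mathlib

open scoped Quaternion Polynomial PowerSeries nonZeroDivisors

noncomputable section

/-! ### Slice regular polynomials in two quaternionic variables -/

/-- The ring `(ℍ[q₁, q₂], +, *)` of slice regular polynomials
`∑ q₁ⁿ q₂ᵐ aₙₘ`, regarded as the ring of polynomials in `q₁` with coefficients in `ℍ[q₂]`.
In Mathlib's `R[X]` the variable is central and the product is the convolution of the coefficients
in their given order, so the product of this ring is the `*`-product
`∑ q₁ⁿ q₂ᵐ ∑ a_{r,s} b_{n-r,m-s}`. -/
abbrev SlicePoly₂ : Type := ℍ[ℝ][X][X]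

namespace SlicePoly₂

/-- The value at the point `(a, b) ∈ ℍ²` of `∑ q₁ⁿ q₂ᵐ aₙₘ`: powers of `a` first, then powers
of `b`, then the coefficient. (It is not multiplicative.) -/
def evalAt (P : SlicePoly₂) (a b : ℍ[ℝ]) : ℍ[ℝ] :=
  P.sum fun n Pn => a ^ n * Pn.sum fun m c => b ^ m * c

/-- The slice regular polynomial `q₁ - a`. -/
def linearFactor (a : ℍ[ℝ]) : SlicePoly₂ :=
  Polynomial.X - Polynomial.C (Polynomial.C a)

/-- The partial Cullen derivative `∑ n q₁ⁿ⁻¹ q₂ᵐ aₙₘ` with respect to `q₁`. -/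
def cullenDeriv₁ (P : SlicePoly₂) : SlicePoly₂ :=
  Polynomial.derivative P

end SlicePoly₂

/-- The set `C_a` of the quaternions that commute with `a`. -/
def commutingSet (a : ℍ[ℝ]) : Set ℍ[ℝ] := {q | q * a = a * q}

namespace SlicePoly₂

/-- `P` vanishes identically on `{a} × C_a`. -/
def VanishesOn (P : SlicePoly₂) (a : ℍ[ℝ]) : Prop :=
  ∀ b ∈ commutingSet a, P.evalAt a b = 0

/-- `{a} × C_a` is a zero of `P` of multiplicity `m`: `P` vanishes on it and
`P = (q₁ - a)^{*m} * Q` for some `Q` that does not vanish identically on `{a} × C_a`. -/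
def HasMultiplicity (P : SlicePoly₂) (a : ℍ[ℝ]) (m : ℕ) : Prop :=
  P.VanishesOn a ∧ ∃ Q : SlicePoly₂, ¬ Q.VanishesOn a ∧ P = linearFactor a ^ m * Q

end SlicePoly₂

/-! ### The Dieudonné determinant over a skew field -/

section Dieudonne

variable {F : Type*} [DivisionRing F]

open Classical in
/-- The class `[x]` of `x ∈ F` in the maximal abelian quotient of `Fˣ` with a zero added. -/
def abClass (x : F) : WithZero (Abelianization Fˣ) :=
  if hx : x = 0 then 0 else (Abelianization.of (Units.mk0 x hx) : Abelianization Fˣ)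

open Classical in
/-- The Dieudonné determinant, by elimination along the first column. If that column is zero the
value is `[0]`. Otherwise let `k` be the first row with `A k 0 ≠ 0`; subtract left multiples of the
`k`-th row from the other rows so that their first entries vanish, delete the first column and the
`k`-th row, and multiply the determinant of what remains by `[A k 0]`. The sign `(-1) ^ k` of the
row move makes this the usual determinant when `F` is commutative; its class is trivial if `F`
contains the quaternions, as `-1 = i * j * i⁻¹ * j⁻¹`. -/
def dieudonneDet : (n : ℕ) → Matrix (Fin n) (Fin n) F → WithZero (Abelianization Fˣ)
  | 0, _ => 1
  | n + 1, A =>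
    if h : ∃ k, A k 0 ≠ 0 then
      abClass ((-1) ^ (Fin.find (fun k => A k 0 ≠ 0) h : ℕ) *
          A (Fin.find (fun k => A k 0 ≠ 0) h) 0) *
        dieudonneDet n (Matrix.of fun i j =>
          A ((Fin.find (fun k => A k 0 ≠ 0) h).succAbove i) j.succ -
            A ((Fin.find (fun k => A k 0 ≠ 0) h).succAbove i) 0 *
              (A (Fin.find (fun k => A k 0 ≠ 0) h) 0)⁻¹ *
                A (Fin.find (fun k => A k 0 ≠ 0) h) j.succ)
    else 0

end Dieudonne

/-! ### Slice regular functions of one variable and their skew field of quotients -/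

/-- The ring `(𝒮ℛ(ℍ), +, *)` of slice regular functions on `ℍ`, i.e. of the power series
`∑ qⁿ aₙ` with quaternionic coefficients that converge on all of `ℍ`; the product is the
`*`-product `∑ qⁿ ∑ aₖ bₙ₋ₖ`. -/
def sliceRegular : Subring ℍ[ℝ]⟦X⟧ where
  carrier := {f | ∀ r : ℝ, 0 ≤ r → Summable fun n => ‖PowerSeries.coeff n f‖ * r ^ n}
  zero_mem' := by
    intro r _
    simp [summable_zero]
  one_mem' := by
    intro r _
    refine summable_of_ne_finset_zero (s := {0}) fun n hn => ?_
    simp only [Finset.mem_singleton] at hn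
    simp [PowerSeries.coeff_one, hn]
  add_mem' := by
    intro f g hf hg r hr
    refine Summable.of_nonneg_of_le (fun n => by positivity) (fun n => ?_)
      ((hf r hr).add (hg r hr))
    rw [map_add, ← add_mul]
    exact mul_le_mul_of_nonneg_right (norm_add_le _ _) (by positivity)
  neg_mem' := by
    intro f hf r hr
    simpa using hf r hr
  mul_mem' := by
    intro f g hf hg r hr
    have hf' := hf r hr
    have hg' := hg r hr
    refine Summable.of_nonneg_of_le (fun n => by positivity) (fun n => ?_)
      (summable_norm_sum_mul_antidiagonal_of_summable_norm hf'.norm hg'.norm)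
    rw [PowerSeries.coeff_mul]
    refine le_trans ?_ (le_abs_self _)
    refine (mul_le_mul_of_nonneg_right (norm_sum_le _ _) (by positivity)).trans ?_
    rw [Finset.sum_mul]
    refine Finset.sum_le_sum fun p hp => ?_
    rw [← Finset.HasAntidiagonal.mem_antidiagonal.mp hp, pow_add, norm_mul]
    exact le_of_eq (by ring)

namespace sliceRegular

/-- The regular conjugate `∑ qⁿ (conjugate of aₙ)`. -/
def conj (f : sliceRegular) : sliceRegular :=
  ⟨PowerSeries.mk fun n => star (PowerSeries.coeff n f.1), fun r hr => by
    simpa using f.2 r hr⟩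

/-- The coefficients of `f^c * f` are real. -/
theorem star_coeff_conj_mul (f : sliceRegular) (n : ℕ) :
    star (PowerSeries.coeff n (conj f * f).1) = PowerSeries.coeff n (conj f * f).1 := by
  change star (PowerSeries.coeff n ((conj f).1 * f.1)) = PowerSeries.coeff n ((conj f).1 * f.1)
  rw [PowerSeries.coeff_mul, star_sum]
  rw [← Finset.Nat.sum_antidiagonal_swap]
  refine Finset.sum_congr rfl fun p _ => ?_
  simp [conj]

theorem conj_mul_comm (f g : sliceRegular) : (conj f * f) * g = g * (conj f * f) := by
  apply Subtype.ext
  ext1 n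
  change PowerSeries.coeff n ((conj f * f).1 * g.1) = PowerSeries.coeff n (g.1 * (conj f * f).1)
  rw [PowerSeries.coeff_mul, PowerSeries.coeff_mul, ← Finset.Nat.sum_antidiagonal_swap]
  refine Finset.sum_congr rfl fun p _ => ?_
  have h := Quaternion.star_eq_self.mp (star_coeff_conj_mul f p.2)
  simp only [Prod.fst_swap, Prod.snd_swap]
  rw [h]
  exact (Quaternion.coe_commutes _ _)

theorem conj_ne_zero {f : sliceRegular} (hf : f ≠ 0) : conj f ≠ 0 := by
  intro h
  apply hf
  apply Subtype.ext
  ext1 n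
  have h1 : PowerSeries.coeff n (conj f).1 = 0 := by rw [h]; simp
  simpa [conj] using h1

/-- `𝒮ℛ(ℍ)` is a left Ore domain: `f^s * g = (g * f^c) * f` with `f^s = f^c * f`. -/
instance : OreLocalization.OreSet sliceRegular⁰ :=
  OreLocalization.oreSetOfNoZeroDivisors
    (fun g f => g * conj f.1)
    (fun _ f => ⟨conj f.1 * f.1, mem_nonZeroDivisors_of_ne_zero
      (mul_ne_zero (conj_ne_zero (nonZeroDivisors.ne_zero f.2)) (nonZeroDivisors.ne_zero f.2))⟩)
    (fun g f => by
      change (conj f.1 * f.1) * g = g * conj f.1 * f.1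
      rw [conj_mul_comm, mul_assoc])

end sliceRegular

/-- The skew field `ℒ(ℍ)` of the left quotients `f^{-*} * g` of slice regular functions on `ℍ`
(the classical ring of quotients of `𝒮ℛ(ℍ)`). -/
abbrev SemiRegular : Type := OreLocalization sliceRegular⁰ sliceRegular

theorem Polynomial.toPowerSeries_mem_sliceRegular (p : ℍ[ℝ][X]) :
    (p : ℍ[ℝ]⟦X⟧) ∈ sliceRegular := by
  intro r _
  refine summable_of_ne_finset_zero (s := p.support) fun n hn => ?_
  simp [Polynomial.notMem_support_iff.mp hn]

/-- The inclusion of `ℍ[q]` into `ℒ(ℍ)`. -/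
def polyToSemiRegular : ℍ[ℝ][X] →+* SemiRegular :=
  (OreLocalization.numeratorRingHom).comp
    (Polynomial.coeToPowerSeries.ringHom.codRestrict sliceRegular
      Polynomial.toPowerSeries_mem_sliceRegular)

/-! ### The regular resultant -/

/-- The regular resultant `Res(P, Q; q₁)`: the Dieudonné determinant over `ℒ(ℍ)` of the Sylvester
matrix of `P = ∑ q₁ᵏ Pₖ(q₂)` and `Q = ∑ q₁ᵏ Qₖ(q₂)`, where `n` and `m` are their degrees in `q₁`.
The first `m` columns hold the shifted coefficients of `P`, the last `n` columns those of `Q`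
(with Mathlib's order of arguments this is the Sylvester matrix of `Q` and `P`). -/
def regularResultant₁ (P Q : SlicePoly₂) : WithZero (Abelianization SemiRegularˣ) :=
  dieudonneDet (Q.natDegree + P.natDegree)
    ((Polynomial.sylvester Q P Q.natDegree P.natDegree).map polyToSemiRegular)

end

/-! ### Vanishing of the Dieudonné determinant -/

/-! Multiplicity at least 2 makes both `P` and its `q₁`-derivative left multiples of `q₁ - a`, by
the product rule. Substituting `a` for `q₁`, with its powers to the left of the coefficients, kills
every left multiple of `q₁ - a`. Each column of the Sylvester matrix lists the coefficients of some
`q₁ʲ * P` or `q₁ʲ * P_{q₁}`, again a left multiple because `q₁` is central. So the row vector `(1,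
a, a², …)` annihilates the matrix from the left. Elimination by left multiples of a pivot row
preserves such a relation, and this forces the Dieudonné determinant to be `[0]`. -/

open Classical in
/-- The Dieudonné determinant of a matrix with left linearly dependent rows is `[0]`. -/
theorem dieudonneDet_eq_zero_of_vecMul_eq_zero {F : Type*} [DivisionRing F] :
    ∀ {n : ℕ} {A : Matrix (Fin n) (Fin n) F} {v : Fin n → F}, v ≠ 0 →
      Matrix.vecMul v A = 0 → dieudonneDet n A = 0
  | 0, _, _, hv, _ => absurd (Subsingleton.elim _ _) hv
  | n + 1, A, v, hv, hA => by
    have hcol (j) : ∑ i, v i * A i j = 0 := congrFun hA j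
    rw [dieudonneDet]
    split_ifs with h
    · have hk := Fin.find_spec h
      generalize Fin.find (fun k => A k 0 ≠ 0) h = k at hk
      simp only [Fin.sum_univ_succAbove _ k] at hcol
      -- Dropping the pivot entry of `v` leaves a relation for the reduced matrix. It is nonzero: if
      -- `v` vanished off `k`, column 0 would give `v k * A k 0 = 0`.
      rw [dieudonneDet_eq_zero_of_vecMul_eq_zero (v := fun i => v (k.succAbove i)), mul_zero]
      · intro h0
        have h0' (i) : v (k.succAbove i) = 0 := congrFun h0 i
        have hvk : v k = 0 := by simpa [h0', hk] using hcol 0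
        exact hv (funext fun i => (Fin.eq_self_or_eq_succAbove k i).elim (fun e => e ▸ hvk)
          fun ⟨l, e⟩ => e ▸ h0' l)
      · funext j
        change ∑ i, v (k.succAbove i) * (A (k.succAbove i) j.succ -
          A (k.succAbove i) 0 * (A k 0)⁻¹ * A k j.succ) = 0
        simp only [mul_sub, Finset.sum_sub_distrib, ← mul_assoc]
        -- By the relations in columns `0` and `j.succ`, both sums equal `-(v k * A k j.succ)`.
        rw [← Finset.sum_mul, ← Finset.sum_mul, eq_neg_of_add_eq_zero_right (hcol 0),
          eq_neg_of_add_eq_zero_right (hcol j.succ), neg_mul, mul_assoc (v k),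
          mul_inv_cancel₀ hk, mul_one, neg_mul, sub_self]
    · rfl

/-! ### Sylvester matrices of polynomials with a common left linear factor -/

namespace Polynomial

variable {R : Type*} [Ring R]

/-- A left multiple of `X - C a` vanishes at `a`, with the powers of `a` to the left of the
coefficients. -/
theorem sum_pow_mul_coeff_X_sub_C_mul (a : R) (p : R[X]) {N : ℕ}
    (hN : ((X - C a) * p).natDegree < N) :
    ∑ i ∈ Finset.range N, a ^ i * ((X - C a) * p).coeff i = 0 := by
  nontriviality R
  obtain ⟨N, rfl⟩ : ∃ M, N = M + 1 := ⟨N - 1, by omega⟩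
  -- The coefficients are `p_{i-1} - a * p_i`, so the sum telescopes; the remaining term vanishes
  -- once `M` exceeds the degree of `p`.
  have key (M : ℕ) :
      ∑ i ∈ Finset.range (M + 1), a ^ i * ((X - C a) * p).coeff i = -(a ^ (M + 1) * p.coeff M) := by
    induction M with
    | zero => simp [sub_mul]
    | succ M ih =>
      rw [Finset.sum_range_succ, ih, coeff_X_sub_C_mul, mul_sub, ← mul_assoc, ← pow_succ]
      abel
  rw [key]
  rcases eq_or_ne p 0 with rfl | hp
  · simp
  · rw [(monic_X_sub_C a).natDegree_mul' hp, natDegree_X_sub_C] at hN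
    rw [coeff_eq_zero_of_natDegree_lt (by omega), mul_zero, neg_zero]

/-- The shifted column holds the coefficients of `X ^ j * ((X - C a) * p)`, and the central `X ^ j`
moves past `X - C a`. -/
theorem sum_pow_mul_shifted_coeff_X_sub_C_mul (a : R) (p : R[X]) {j n N : ℕ}
    (hn : ((X - C a) * p).natDegree ≤ n) (hN : j + n < N) :
    ∑ i : Fin N, a ^ (i : ℕ) *
      (if (i : ℕ) ∈ Set.Icc j (j + n) then ((X - C a) * p).coeff (i - j) else 0) = 0 := by
  have hshift : X ^ j * ((X - C a) * p) = (X - C a) * (X ^ j * p) := by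
    rw [← mul_assoc, (commute_X_pow (X - C a) j).eq, mul_assoc]
  have hdeg : ((X - C a) * (X ^ j * p)).natDegree < N := by
    rw [← hshift]
    have h1 := natDegree_mul_le (p := X ^ j) (q := (X - C a) * p)
    have h2 := natDegree_X_pow_le (R := R) j
    omega
  refine Eq.trans ?_ (sum_pow_mul_coeff_X_sub_C_mul a (X ^ j * p) hdeg)
  rw [Finset.sum_range]
  refine Finset.sum_congr rfl fun i _ => ?_
  rw [← hshift, coeff_X_pow_mul']
  by_cases h1 : j ≤ (i : ℕ)
  · by_cases h2 : (i : ℕ) ≤ j + n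
    · simp [h1, h2]
    · rw [coeff_eq_zero_of_natDegree_lt (by omega)]
      simp
  · simp [h1]

/-- The powers of `a` are a left linear relation between the rows of the Sylvester matrix of two
polynomials with the common left factor `X - C a`. -/
theorem vecMul_sylvester_of_left_factor (a : R) {f g p q : R[X]} {m n : ℕ}
    (hf : f = (X - C a) * p) (hg : g = (X - C a) * q)
    (hm : f.natDegree ≤ m) (hn : g.natDegree ≤ n) :
    Matrix.vecMul (fun i : Fin (m + n) => a ^ (i : ℕ)) (sylvester f g m n) = 0 := by
  subst hf hg
  funext j
  change ∑ i : Fin (m + n), a ^ (i : ℕ) * sylvester _ _ m n i j = 0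
  induction j using Fin.addCases with
  | left j =>
    simp only [sylvester, Matrix.of_apply, Fin.addCases_left]
    exact sum_pow_mul_shifted_coeff_X_sub_C_mul a q hn (by omega)
  | right j =>
    simp only [sylvester, Matrix.of_apply, Fin.addCases_right]
    exact sum_pow_mul_shifted_coeff_X_sub_C_mul a p hm (by omega)

/-- The derivative of a left multiple of `(X - C a) ^ (k + 2)` is a left multiple of `X - C a`. -/
theorem exists_derivative_X_sub_C_pow_mul (a : R) (k : ℕ) (q : R[X]) :
    ∃ r, derivative ((X - C a) ^ (k + 2) * q) = (X - C a) * r :=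
  ⟨(X - C a) ^ k * q + derivative ((X - C a) ^ (k + 1) * q), by
    rw [pow_succ' _ (k + 1), mul_assoc, derivative_mul, derivative_X_sub_C, one_mul, mul_add,
      ← mul_assoc, ← pow_succ']⟩

end Polynomial

theorem mainTheorem7 (a b : ℍ[ℝ]) (hb : b ∈ commutingSet a) (P : SlicePoly₂)
    (hP : P.evalAt a b = 0) (m : ℕ) (hmult : P.HasMultiplicity a m) (hm : 2 ≤ m) :
    regularResultant₁ P P.cullenDeriv₁ = 0 := by
  obtain ⟨-, Q, hQ, hPQ⟩ := hmult
  obtain ⟨k, rfl⟩ := Nat.exists_eq_add_of_le' hm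
  have hQ0 : Q ≠ 0 := by
    rintro rfl
    exact hQ fun _ _ => by simp [SlicePoly₂.evalAt]
  -- The matrix must be nonempty: the determinant of size 0 is `1`, and the relation is nonzero
  -- because its entry at index 0 is `a ^ 0 = 1`.
  have hdeg : 0 < P.natDegree := by
    rw [hPQ, SlicePoly₂.linearFactor,
      ((Polynomial.monic_X_sub_C _).pow _).natDegree_mul' hQ0,
      (Polynomial.monic_X_sub_C _).natDegree_pow, Polynomial.natDegree_X_sub_C]
    omega
  obtain ⟨r, hr⟩ := Polynomial.exists_derivative_X_sub_C_pow_mul (Polynomial.C a) k Q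
  have hP1 : P = (Polynomial.X - Polynomial.C (Polynomial.C a)) *
      (SlicePoly₂.linearFactor a ^ (k + 1) * Q) := by
    rw [hPQ, pow_succ', mul_assoc]
    rfl
  have hP2 : P.cullenDeriv₁ = (Polynomial.X - Polynomial.C (Polynomial.C a)) * r := by
    rw [← hr, hPQ]
    rfl
  have hrel := Polynomial.vecMul_sylvester_of_left_factor (Polynomial.C a) hP2 hP1 le_rfl le_rfl
  -- The relation over `ℍ[q₂]` is carried to `ℒ(ℍ)` by the ring homomorphism.
  refine dieudonneDet_eq_zero_of_vecMul_eq_zero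
    (v := fun i => polyToSemiRegular (Polynomial.C a ^ (i : ℕ))) (fun h0 => ?_) ?_
  · simpa using congrFun h0 ⟨0, by omega⟩
  · funext j
    simpa [Matrix.vecMul, dotProduct] using congrArg polyToSemiRegular (congrFun hrel j)
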